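/- Let $K$ and $K'$ be compact topological groups (for example, compact Lie groups), and let $\rho$ and $\rho'$ be continuous complex-linear representations of $K$ and $K'$, respectively, on $\mathbb{C}^n$. Assume that every entire function $h:\mathbb{C}^n\to\mathbb{C}$ with $h(\rho(g)z)=h(z)$ for all $g\in K$ and $z\in\mathbb{C}^n$ is constant, and likewise that every $\rho'$-invariant entire function on $\mathbb{C}^n$ is constant. Let $D$ and $D'$ be bounded domains in $\mathbb{C}^n$ containing the origin such that $\rho(g)(D)=D$ for all $g\in K$ and $\rho'(g')(D')=D'$ for all $g'\in K'$. If $f:D\to D'$ is a biholomorphism with $f(0)=0$, then its complex Jacobian determinant $z\mapsto\det\left(\partial f_i/\partial z_j(z)\right)$ is constant on $D$. -/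

import Mathlib

/-- Complex `n`-space `ℂⁿ` with its standard Hermitian norm. -/
abbrev CSpace (n : ℕ) : Type := EuclideanSpace ℂ (Fin n)

/-- A linear representation `ρ` of a topological group `K` on `ℂⁿ` is continuous if the
linear action `K × ℂⁿ → ℂⁿ` is continuous. -/
def IsContinuousRep {n : ℕ} {K : Type*} [Group K] [TopologicalSpace K]
    (ρ : Representation ℂ K (CSpace n)) : Prop :=
  Continuous fun p : K × CSpace n => ρ p.1 p.2

/-- The algebra of `ρ`-invariant entire functions on `ℂⁿ` consists of the constants only. -/
def InvariantEntireFunctionsConstant {n : ℕ} {K : Type*} [Group K]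
    (ρ : Representation ℂ K (CSpace n)) : Prop :=
  ∀ h : CSpace n → ℂ, Differentiable ℂ h → (∀ (g : K) (z : CSpace n), h (ρ g z) = h z) →
    ∃ c : ℂ, ∀ z : CSpace n, h z = c

/-- A bounded domain of `ℂⁿ`: a nonempty, connected, open, bounded set. -/
structure IsBoundedDomain {n : ℕ} (D : Set (CSpace n)) : Prop where
  isOpen : IsOpen D
  isConnected : IsConnected D
  isBounded : Bornology.IsBounded D

/-- `D` is `ρ`-invariant: every `ρ(g)` maps `D` onto itself. -/
def IsInvariantUnder {n : ℕ} {K : Type*} [Group K]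
    (ρ : Representation ℂ K (CSpace n)) (D : Set (CSpace n)) : Prop :=
  ∀ g : K, ρ g '' D = D

/-- `f` restricts to a biholomorphism from `D` onto `D'`: it is holomorphic on `D`, maps `D`
into `D'`, and has a two-sided inverse `D' → D` that is holomorphic on `D'`. -/
def IsBiholomorphism {n : ℕ} (f : CSpace n → CSpace n) (D D' : Set (CSpace n)) : Prop :=
  DifferentiableOn ℂ f D ∧ Set.MapsTo f D D' ∧
    ∃ F : CSpace n → CSpace n,
      DifferentiableOn ℂ F D' ∧ Set.MapsTo F D' D ∧ Set.InvOn F f D D'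

/-- The complex Jacobian determinant `det (∂fᵢ/∂zⱼ)` of `f` at `z`, i.e. the determinant of the
complex derivative of `f` at `z`. -/
noncomputable def complexJacobian {n : ℕ} (f : CSpace n → CSpace n) (z : CSpace n) : ℂ :=
  (fderiv ℂ f z).det

/-! Averaging a holomorphic `h` on `D` over the Haar measure of `K` gives an invariant function. Its
homogeneous Taylor parts at 0 are invariant entire functions, so the average is the constant `h 0`.
Each `ρ g` preserves volume, so Fubini yields the mean value property `∫_D h = vol(D) h(0)` for
integrable `h` (`InvariantEntireFunctionsConstant.setIntegral_eq`). Write `J` for the complex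
Jacobian. Since `∫_D |J_f|² = vol(D')`, the mean value property for `J_f` gives `∫_D |J_f - J_f(0)|²
= vol(D') - |J_f(0)|² vol(D)` (`setIntegral_norm_complexJacobian_sub_sq`). The inverse `F` likewise
gives `vol(D) - |J_F(0)|² vol(D') ≥ 0`. As `J_F(0) J_f(0) = 1`, this forces the first variance to be
at most 0, hence zero. -/

open MeasureTheory Metric Set Filter
open scoped Topology

/-! ### Holomorphic functions of several variables, by restriction to complex lines. -/

section Holomorphic

universe u

variable {E G : Type*} [NormedAddCommGroup E] [NormedSpace ℂ E]
  [NormedAddCommGroup G] [NormedSpace ℂ G]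

/-- A continuous linear map out of a finite-dimensional space is determined by its values on a
basis. -/
theorem ContinuousLinearMap.eq_sum_smulRight_finBasis [FiniteDimensional ℂ E] (A : E →L[ℂ] G) :
    A = ∑ i, ContinuousLinearMap.smulRightL ℂ E G
      (LinearMap.toContinuousLinearMap ((Module.finBasis ℂ E).coord i))
      (A (Module.finBasis ℂ E i)) := by
  ext v
  have h := congrArg A ((Module.finBasis ℂ E).sum_repr v)
  rw [map_sum] at h
  simpa using h.symm

theorem hasDerivAt_comp_line {f : E → G} {x v : E} {t : ℂ} (hf : DifferentiableAt ℂ f (x + t • v)) :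
    HasDerivAt (fun s : ℂ => f (x + s • v)) (fderiv ℂ f (x + t • v) v) t := by
  have h : HasDerivAt (fun s : ℂ => x + s • v) v t := by
    simpa using ((hasDerivAt_id t).smul_const v).const_add x
  exact hf.hasFDerivAt.comp_hasDerivAt t h

/-- Cauchy's estimate for the Fréchet derivative of a bounded holomorphic function. -/
theorem norm_fderiv_le_of_forall_mem_ball_norm_le {f : E → G} {x : E} {r M : ℝ} (hr : 0 < r)
    (hM : 0 ≤ M) (hf : DifferentiableOn ℂ f (ball x r)) (hb : ∀ y ∈ ball x r, ‖f y‖ ≤ M) :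
    ‖fderiv ℂ f x‖ ≤ M / (r / 2) := by
  refine ContinuousLinearMap.opNorm_le_bound _ (by positivity) fun v => ?_
  rcases eq_or_ne v 0 with rfl | hv
  · simp
  have hv' : 0 < ‖v‖ := norm_pos_iff.mpr hv
  have hmem : ∀ t ∈ closedBall (0 : ℂ) (r / 2 / ‖v‖), x + t • v ∈ ball x r := by
    intro t ht
    rw [mem_closedBall_zero_iff, le_div_iff₀ hv'] at ht
    rw [mem_ball_iff_norm, add_sub_cancel_left, norm_smul]
    linarith
  have hd : ∀ t ∈ closedBall (0 : ℂ) (r / 2 / ‖v‖),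
      HasDerivAt (fun s : ℂ => f (x + s • v)) (fderiv ℂ f (x + t • v) v) t := fun t ht =>
    hasDerivAt_comp_line (hf.differentiableAt (isOpen_ball.mem_nhds (hmem t ht)))
  have hR : 0 < r / 2 / ‖v‖ := by positivity
  have h := Complex.norm_deriv_le_of_forall_mem_sphere_norm_le (c := 0) hR
    (DifferentiableOn.diffContOnCl (f := fun s : ℂ => f (x + s • v)) (by
      intro t ht
      rw [closure_ball _ hR.ne'] at ht
      exact (hd t ht).differentiableAt.differentiableWithinAt))
    (fun t ht => hb _ (hmem t (sphere_subset_closedBall ht)))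
  have h0 := (hd 0 (mem_closedBall_self hR.le)).deriv
  rw [h0] at h
  simp only [zero_smul, add_zero] at h
  refine h.trans_eq ?_
  field_simp

/-- The integral of a bounded family of holomorphic functions is holomorphic. -/
theorem differentiableAt_integral_of_norm_le [FiniteDimensional ℂ E] [CompleteSpace G] {α : Type*}
    [MeasurableSpace α] {μ : Measure α} [IsFiniteMeasure μ] {F : E → α → G} {x₀ : E} {r M : ℝ}
    (hr : 0 < r) (hmeas : ∀ x ∈ ball x₀ r, AEStronglyMeasurable (F x) μ)
    (hF : ∀ a, DifferentiableOn ℂ (F · a) (ball x₀ r))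
    (hb : ∀ a, ∀ x ∈ ball x₀ r, ‖F x a‖ ≤ M) :
    DifferentiableAt ℂ (fun x => ∫ a, F x a ∂μ) x₀ := by
  have hM : 0 ≤ |M| := abs_nonneg M
  have hb' : ∀ a, ∀ x ∈ ball x₀ r, ‖F x a‖ ≤ |M| := fun a x hx => (hb a x hx).trans (le_abs_self M)
  have hx₀ : x₀ ∈ ball x₀ r := mem_ball_self hr
  have hd : ∀ a, ∀ x ∈ ball x₀ r, DifferentiableAt ℂ (F · a) x := fun a x hx =>
    (hF a).differentiableAt (isOpen_ball.mem_nhds hx)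
  have hsub : ∀ x ∈ ball x₀ (r / 2), ball x (r / 2) ⊆ ball x₀ r := fun x hx =>
    ball_subset_ball' (by rw [mem_ball] at hx; linarith)
  have happ : ∀ v, AEStronglyMeasurable (fun a => fderiv ℂ (F · a) x₀ v) μ := by
    intro v
    have hlim : Tendsto (fun n : ℕ => ((n : ℂ) + 1)⁻¹) atTop (𝓝[≠] 0) := by
      refine tendsto_nhdsWithin_iff.mpr ⟨?_, Eventually.of_forall fun n =>
        inv_ne_zero (Nat.cast_add_one_ne_zero n)⟩
      simpa using tendsto_one_div_add_atTop_nhds_zero_nat (𝕜 := ℂ)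
    have hpt : Tendsto (fun n : ℕ => x₀ + ((n : ℂ) + 1)⁻¹ • v) atTop (𝓝 x₀) := by
      simpa using ((hlim.mono_right nhdsWithin_le_nhds).smul_const v).const_add x₀
    -- Starting the difference quotients at `N` keeps every evaluation point in the ball where `F`
    -- is measurable.
    obtain ⟨N, hN⟩ := eventually_atTop.mp (hpt.eventually (isOpen_ball.mem_nhds hx₀))
    refine aestronglyMeasurable_of_tendsto_ae (u := atTop)
      (f := fun n a => ((((n + N : ℕ) : ℂ) + 1)⁻¹)⁻¹ •
        (F (x₀ + (((n + N : ℕ) : ℂ) + 1)⁻¹ • v) a - F x₀ a)) (fun n => ?_) (ae_of_all _ fun a => ?_)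
    · exact ((hmeas _ (hN _ (by omega))).sub (hmeas _ hx₀)).const_smul _
    · have h1 := hasDerivAt_comp_line (f := (F · a)) (x := x₀) (v := v) (t := 0)
        (by simpa using hd a x₀ hx₀)
      rw [hasDerivAt_iff_tendsto_slope_zero] at h1
      have h2 := (h1.comp hlim).comp (tendsto_add_atTop_nat N)
      simpa [Function.comp_def] using h2
  -- The bound is Cauchy's estimate on balls of radius `r / 2` centred in `ball x₀ (r / 2)`.
  refine (hasFDerivAt_integral_of_dominated_loc_of_lip (𝕜 := ℂ)
    (F' := fun a => fderiv ℂ (F · a) x₀) (bound := fun _ => |M| / (r / 2 / 2))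
    (ball_mem_nhds x₀ (half_pos hr)) ?_ ?_ ?_ ?_ (integrable_const _) ?_).2.differentiableAt
  · filter_upwards [ball_mem_nhds x₀ hr] with x hx using hmeas x hx
  · exact (integrable_const |M|).mono' (hmeas _ hx₀) (ae_of_all _ fun a => hb' a _ hx₀)
  · have : (fun a => fderiv ℂ (F · a) x₀) = fun a => ∑ i, ContinuousLinearMap.smulRightL ℂ E G
      (LinearMap.toContinuousLinearMap ((Module.finBasis ℂ E).coord i))
      (fderiv ℂ (F · a) x₀ (Module.finBasis ℂ E i)) :=
      funext fun a => ContinuousLinearMap.eq_sum_smulRight_finBasis _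
    rw [this]
    exact Finset.aestronglyMeasurable_fun_sum _ fun i _ =>
      (ContinuousLinearMap.continuous _).comp_aestronglyMeasurable (happ _)
  · refine ae_of_all _ fun a => ?_
    refine (convex_ball x₀ (r / 2)).lipschitzOnWith_of_nnnorm_fderiv_le (𝕜 := ℂ)
      (fun x hx => hd a x (ball_subset_ball (by linarith) hx)) fun x hx => ?_
    have h := norm_fderiv_le_of_forall_mem_ball_norm_le (f := (F · a)) (half_pos hr) hM
      ((hF a).mono (hsub x hx)) fun y hy => hb' a y (hsub x hx hy)
    rw [← NNReal.coe_le_coe, coe_nnnorm, Real.coe_nnabs]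
    exact h.trans (le_abs_self _)
  · exact ae_of_all _ fun a => (hd a x₀ hx₀).hasFDerivAt

/-- The Fréchet derivative of a holomorphic function of several variables is holomorphic. -/
theorem differentiableOn_fderiv_of_isOpen [FiniteDimensional ℂ E] [CompleteSpace G]
    {f : E → G} {U : Set E} (hU : IsOpen U) (hf : DifferentiableOn ℂ f U) :
    DifferentiableOn ℂ (fderiv ℂ f) U := by
  have hd : ∀ x ∈ U, DifferentiableAt ℂ f x := fun x hx => hf.differentiableAt (hU.mem_nhds hx)
  have hv : ∀ v, DifferentiableOn ℂ (fun z => fderiv ℂ f z v) U := by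
    intro v z₀ hz₀
    refine DifferentiableAt.differentiableWithinAt ?_
    obtain ⟨M, hM⟩ : ∃ M, ∀ᶠ y in 𝓝 z₀, ‖f y‖ ≤ M :=
      ⟨‖f z₀‖ + 1, (hd z₀ hz₀).continuousAt.norm.eventually_le_const (lt_add_one _)⟩
    obtain ⟨r, hr, hball⟩ := Metric.mem_nhds_iff.mp (hM.and (hU.mem_nhds hz₀))
    -- This makes `‖t • v‖ ≤ r / 2` on the circle; the `+ 1` covers `v = 0`.
    set ε : ℝ := r / 2 / (‖v‖ + 1) with hε
    have hv1 : 0 < ‖v‖ + 1 := by positivity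
    have hε0 : 0 < ε := by positivity
    have hmem : ∀ z ∈ ball z₀ (r / 2), ∀ t ∈ closedBall (0 : ℂ) ε, z + t • v ∈ ball z₀ r := by
      intro z hz t ht
      rw [mem_closedBall_zero_iff] at ht
      rw [mem_ball_iff_norm] at hz ⊢
      have h1 : ‖t • v‖ ≤ r / 2 := by
        rw [norm_smul]
        calc ‖t‖ * ‖v‖ ≤ ε * (‖v‖ + 1) := by gcongr; linarith
          _ = r / 2 := by rw [hε]; field_simp
      calc ‖z + t • v - z₀‖ = ‖(z - z₀) + t • v‖ := by congr 1; abel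
        _ ≤ ‖z - z₀‖ + ‖t • v‖ := norm_add_le _ _
        _ < r := by linarith
    -- Cauchy's formula on a circle independent of `z`, so that the integrand is holomorphic in `z`.
    have hcauchy : ∀ z ∈ ball z₀ (r / 2), (2 * Real.pi * Complex.I : ℂ)⁻¹ •
        (∫ θ in Ioc 0 (2 * Real.pi), deriv (circleMap 0 ε) θ •
          ((circleMap 0 ε θ - 0) ^ 2)⁻¹ • f (z + circleMap 0 ε θ • v)) = fderiv ℂ f z v := by
      intro z hz
      have hopen : IsOpen ((fun t : ℂ => z + t • v) ⁻¹' ball z₀ r) :=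
        isOpen_ball.preimage (by fun_prop)
      have h := Complex.cderiv_eq_deriv (f := fun t : ℂ => f (z + t • v)) (z := 0) hopen
        (fun t ht => (hasDerivAt_comp_line
          (hd _ (hball ht).2)).differentiableAt.differentiableWithinAt) hε0
        (fun t ht => hmem z hz t ht)
      rw [Complex.cderiv, circleIntegral,
        intervalIntegral.integral_of_le Real.two_pi_pos.le] at h
      rw [h]
      have h0 := (hasDerivAt_comp_line (f := f) (x := z) (v := v) (t := 0)
        (hd _ (hball (hmem z hz 0 (mem_closedBall_self hε0.le))).2)).deriv
      simpa using h0
    have hcirc : ∀ θ, circleMap 0 ε θ ∈ closedBall (0 : ℂ) ε := fun θ =>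
      circleMap_mem_closedBall 0 hε0.le θ
    have hint : DifferentiableAt ℂ (fun z => ∫ θ in Ioc 0 (2 * Real.pi),
        deriv (circleMap 0 ε) θ • ((circleMap 0 ε θ - 0) ^ 2)⁻¹ •
          f (z + circleMap 0 ε θ • v)) z₀ := by
      refine differentiableAt_integral_of_norm_le (half_pos hr) (M := ε * ((ε ^ 2)⁻¹ * M))
        (fun z hz => ?_) (fun θ z hz => ?_) (fun θ z hz => ?_)
      · refine Continuous.aestronglyMeasurable ?_
        have hne : ∀ θ, (circleMap 0 ε θ - 0) ^ 2 ≠ 0 := fun θ => by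
          simpa using hε0.ne'
        have hcont : Continuous fun θ => f (z + circleMap 0 ε θ • v) :=
          continuous_iff_continuousAt.mpr fun θ =>
            ContinuousAt.comp (f := fun θ => z + circleMap 0 ε θ • v)
              (hd _ (hball (hmem z hz _ (hcirc θ))).2).continuousAt
              (by have := continuous_circleMap 0 ε; fun_prop)
        have hc := continuous_circleMap 0 ε
        simp only [deriv_circleMap]
        exact (by fun_prop : Continuous fun θ => circleMap 0 ε θ * Complex.I).smul
          (Continuous.smul (Continuous.inv₀ (by fun_prop) hne) hcont)
      · refine DifferentiableAt.differentiableWithinAt ?_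
        refine DifferentiableAt.const_smul (DifferentiableAt.const_smul ?_ _) _
        exact DifferentiableAt.comp (g := f) (f := fun z => z + circleMap 0 ε θ • v) z
          (hd _ (hball (hmem z hz _ (hcirc θ))).2) (by fun_prop)
      · have := (hball (hmem z hz _ (hcirc θ))).1
        rw [norm_smul, norm_smul, deriv_circleMap]
        simp only [norm_mul, norm_circleMap_zero, Complex.norm_I, sub_zero, norm_inv, norm_pow,
          mul_one, abs_of_pos hε0]
        gcongr
    refine (hint.const_smul (2 * Real.pi * Complex.I : ℂ)⁻¹).congr_of_eventuallyEq ?_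
    filter_upwards [ball_mem_nhds z₀ (half_pos hr)] with z hz using (hcauchy z hz).symm
  have : fderiv ℂ f = fun z => ∑ i, ContinuousLinearMap.smulRightL ℂ E G
      (LinearMap.toContinuousLinearMap ((Module.finBasis ℂ E).coord i))
      (fderiv ℂ f z (Module.finBasis ℂ E i)) :=
    funext fun z => ContinuousLinearMap.eq_sum_smulRight_finBasis _
  rw [this]
  exact DifferentiableOn.fun_sum fun i _ =>
    (ContinuousLinearMap.differentiable _).comp_differentiableOn (hv _)

/-- Holomorphic functions of several variables are smooth. -/
theorem contDiffOn_of_differentiableOn_isOpen {E : Type u} [NormedAddCommGroup E] [NormedSpace ℂ E]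
    [FiniteDimensional ℂ E] {U : Set E} (hU : IsOpen U) (k : ℕ) :
    ∀ {G : Type u} [NormedAddCommGroup G] [NormedSpace ℂ G] [CompleteSpace G] {f : E → G},
      DifferentiableOn ℂ f U → ContDiffOn ℂ k f U := by
  induction k with
  | zero => intro G _ _ _ f hf; exact contDiffOn_zero.mpr hf.continuousOn
  | succ k ih =>
    intro G _ _ _ f hf
    rw [Nat.cast_succ, contDiffOn_succ_iff_fderiv_of_isOpen hU]
    -- The derivative takes values in `E →L[ℂ] G`: hence the induction over all `G`, in the universe
    -- of `E`.
    exact ⟨hf, by simp, ih (differentiableOn_fderiv_of_isOpen hU hf)⟩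

/-- If a holomorphic function on a connected open set is constant near a point, it is constant. -/
theorem DifferentiableOn.eqOn_const_of_eventuallyEq {f : E → ℂ} {U : Set E} (hU : IsOpen U)
    (hconn : IsConnected U) (hf : DifferentiableOn ℂ f U) {x₀ : E} {c : ℂ} (hx₀ : x₀ ∈ U)
    (hc : ∀ᶠ x in 𝓝 x₀, f x = c) : ∀ x ∈ U, f x = c := by
  have key : U ⊆ {x | ∀ᶠ y in 𝓝 x, f y = c} := by
    refine hconn.isPreconnected.subset_of_closure_inter_subset isOpen_setOfPred_eventually_nhds
      ⟨x₀, hx₀, hc⟩ ?_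
    rintro x ⟨hxcl, hxU⟩
    obtain ⟨r, hr, hball⟩ := Metric.isOpen_iff.mp hU x hxU
    obtain ⟨w, hw, hwx⟩ := Metric.mem_closure_iff.mp hxcl r hr
    rw [dist_comm] at hwx
    refine mem_of_superset (ball_mem_nhds x hr) fun z hz => ?_
    have hline : Continuous fun t : ℂ => w + t • (z - w) := by fun_prop
    -- Convexity makes this slice connected, so the one-variable identity theorem passes from `w`
    -- (`t = 0`) to `z` (`t = 1`).
    have hconv : Convex ℝ ((fun t : ℂ => w + t • (z - w)) ⁻¹' ball x r) := by
      intro s hs t ht a b ha hb hab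
      have h := convex_ball x r hs ht ha hb hab
      rw [mem_preimage]
      convert h using 1
      obtain rfl : b = 1 - a := by linarith
      simp only [← Complex.coe_smul, Complex.ofReal_sub, Complex.ofReal_one]
      module
    have hopen : IsOpen ((fun t : ℂ => w + t • (z - w)) ⁻¹' ball x r) := isOpen_ball.preimage hline
    have han : AnalyticOnNhd ℂ (fun t : ℂ => f (w + t • (z - w)))
        ((fun t : ℂ => w + t • (z - w)) ⁻¹' ball x r) :=
      DifferentiableOn.analyticOnNhd (fun t ht => (hasDerivAt_comp_line
        (hf.differentiableAt (hU.mem_nhds (hball ht)))).differentiableAt.differentiableWithinAt)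
        hopen
    have h := han.eqOn_of_preconnected_of_eventuallyEq (analyticOnNhd_const (v := c))
      hconv.isPreconnected (z₀ := 0) (by simpa using hwx) (by
        have h0 : Tendsto (fun t : ℂ => w + t • (z - w)) (𝓝 0) (𝓝 w) := by
          simpa using hline.tendsto 0
        exact h0.eventually hw)
    simpa using h (x := 1) (by simpa using hz)
  exact fun x hx => (key hx).self_of_nhds

/-- Reduces the homogeneous Taylor parts of `f` to one-variable derivatives, both for summing the
series and for transferring invariance. -/
theorem iteratedDeriv_smul_line_zero {E : Type} [NormedAddCommGroup E] [NormedSpace ℂ E]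
    [FiniteDimensional ℂ E] {f : E → ℂ} {U : Set E}
    (hU : IsOpen U) (h0 : (0 : E) ∈ U) (hf : DifferentiableOn ℂ f U) (k : ℕ) (z : E) :
    iteratedDeriv k (fun t : ℂ => f (t • z)) 0 = iteratedFDeriv ℂ k f 0 fun _ => z := by
  set g : ℂ →L[ℂ] E := (ContinuousLinearMap.id ℂ ℂ).smulRight z
  have hopen : IsOpen (g ⁻¹' U) := hU.preimage g.continuous
  have hg0 : g 0 ∈ U := by simpa using h0
  have h := g.iteratedFDerivWithin_comp_right (contDiffOn_of_differentiableOn_isOpen hU k hf)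
    hU.uniqueDiffOn hopen.uniqueDiffOn hg0 le_rfl
  rw [iteratedFDerivWithin_of_isOpen k hopen hg0, iteratedFDerivWithin_of_isOpen k hU hg0] at h
  rw [iteratedDeriv_eq_iteratedFDeriv]
  have h' := congrArg (fun A => A fun _ => (1 : ℂ)) h
  simpa [g, Function.comp_def] using h'

/-- If all homogeneous parts of positive degree at the origin vanish, then `f` is constant. -/
theorem DifferentiableOn.eqOn_const_of_iteratedFDeriv_eq_zero {E : Type}
    [NormedAddCommGroup E] [NormedSpace ℂ E] [FiniteDimensional ℂ E] {f : E → ℂ}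
    {U : Set E} (hU : IsOpen U) (hconn : IsConnected U) (h0 : (0 : E) ∈ U)
    (hf : DifferentiableOn ℂ f U)
    (hk : ∀ k : ℕ, k ≠ 0 → ∀ z, (iteratedFDeriv ℂ k f 0 fun _ => z) = 0) :
    ∀ x ∈ U, f x = f 0 := by
  refine hf.eqOn_const_of_eventuallyEq hU hconn h0 ?_
  obtain ⟨r, hr, hball⟩ := Metric.isOpen_iff.mp hU 0 h0
  refine mem_of_superset (ball_mem_nhds 0 hr) fun z hz => ?_
  have hz' : ‖z‖ < r := by simpa using hz
  have hn : 0 < (‖z‖ + r) / 2 := by positivity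
  -- The midpoint of `‖z‖` and `r` is positive even for `z = 0` and below `r`, so the disc of radius
  -- `R` contains `t = 1`.
  set R : ℝ := r / ((‖z‖ + r) / 2) with hR
  have hR1 : 1 < R := by rw [hR, one_lt_div hn]; linarith
  have hmem : ∀ t ∈ ball (0 : ℂ) R, t • z ∈ U := by
    intro t ht
    apply hball
    rw [mem_ball_zero_iff, hR, lt_div_iff₀ hn] at ht
    rw [mem_ball_zero_iff, norm_smul]
    have : ‖t‖ * ‖z‖ ≤ ‖t‖ * ((‖z‖ + r) / 2) := by gcongr; linarith
    linarith
  have hd : DifferentiableOn ℂ (fun t : ℂ => f (t • z)) (ball 0 R) := fun t ht =>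
    (DifferentiableAt.comp (g := f) (f := fun t : ℂ => t • z) t
      (hf.differentiableAt (hU.mem_nhds (hmem t ht))) (by fun_prop)).differentiableWithinAt
  have h := Complex.hasSum_taylorSeries_on_ball hd (z := 1) (by simpa using hR1)
  have h2 := hasSum_single (f := fun n : ℕ => (n.factorial : ℂ)⁻¹ • (1 - 0 : ℂ) ^ n •
    iteratedDeriv n (fun t : ℂ => f (t • z)) 0) 0 (fun n hn => by
      simp [iteratedDeriv_smul_line_zero hU h0 hf, hk n hn])
  have := h.unique h2
  simpa using this

end Holomorphic

/-! ### Determinants of complex linear maps. -/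

section Jacobian

variable {E : Type*} [NormedAddCommGroup E] [NormedSpace ℂ E] [FiniteDimensional ℂ E]

/-- The real determinant of a complex linear map is the squared modulus of the complex one. -/
theorem abs_det_restrictScalars_real (A : E →L[ℂ] E) :
    |(A.restrictScalars ℝ).det| = ‖A.det‖ ^ 2 := by
  have h : (A.restrictScalars ℝ).det = Complex.normSq A.det := by
    rw [← Algebra.norm_complex_apply]
    exact LinearMap.det_restrictScalars (R := ℝ) (S := ℂ) (f := (A : E →ₗ[ℂ] E))
  rw [h, abs_of_nonneg (Complex.normSq_nonneg _), Complex.normSq_eq_norm_sq]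

theorem differentiable_continuousLinearMap_det :
    Differentiable ℂ fun A : E →L[ℂ] E => A.det := by
  have h : (fun A : E →L[ℂ] E => A.det) = fun A => ∑ σ : Equiv.Perm (Fin (Module.finrank ℂ E)),
      ((Equiv.Perm.sign σ : ℤ) : ℂ) * ∏ i, LinearMap.toContinuousLinearMap
        ((Module.finBasis ℂ E).coord (σ i)) (A (Module.finBasis ℂ E i)) := by
    ext A
    rw [ContinuousLinearMap.det, ← LinearMap.det_toMatrix (Module.finBasis ℂ E), Matrix.det_apply']
    simp [LinearMap.toMatrix_apply]
  rw [h]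
  refine Differentiable.fun_sum fun σ _ => Differentiable.const_mul ?_ _
  exact fun A => (HasFDerivAt.finsetProd fun i _ =>
    (by fun_prop : DifferentiableAt ℂ (fun A : E →L[ℂ] E => LinearMap.toContinuousLinearMap
      ((Module.finBasis ℂ E).coord (σ i)) (A (Module.finBasis ℂ E i))) A).hasFDerivAt
    ).differentiableAt

end Jacobian

variable {n : ℕ}

theorem differentiableOn_complexJacobian {f : CSpace n → CSpace n} {D : Set (CSpace n)}
    (hD : IsOpen D) (hf : DifferentiableOn ℂ f D) :
    DifferentiableOn ℂ (complexJacobian f) D :=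
  differentiable_continuousLinearMap_det.comp_differentiableOn
    (differentiableOn_fderiv_of_isOpen hD hf)

/-! ### Invariant domains and the mean value property. -/

section Representation

variable {K : Type*} [Group K] {ρ : Representation ℂ K (CSpace n)} {D : Set (CSpace n)}

theorem IsInvariantUnder.map_mem (hinv : IsInvariantUnder ρ D) (g : K) {z : CSpace n}
    (hz : z ∈ D) : ρ g z ∈ D :=
  hinv g ▸ mem_image_of_mem _ hz

/-- If the invariant entire functions are constant, so are the invariant holomorphic functions on
an invariant domain containing the origin. -/
theorem InvariantEntireFunctionsConstant.eqOn_const (hconst : InvariantEntireFunctionsConstant ρ)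
    (hD : IsBoundedDomain D) (h0 : (0 : CSpace n) ∈ D) {h : CSpace n → ℂ}
    (hh : DifferentiableOn ℂ h D) (hinv : ∀ g, ∀ z ∈ D, h (ρ g z) = h z) :
    ∀ z ∈ D, h z = h 0 := by
  refine hh.eqOn_const_of_iteratedFDeriv_eq_zero hD.isOpen hD.isConnected h0 fun k hk z => ?_
  obtain ⟨c, hc⟩ := hconst (fun z => iteratedFDeriv ℂ k h 0 fun _ => z)
    (by
      refine (iteratedFDeriv ℂ k h 0).contDiff.differentiable (n := 1) (by simp) |>.comp ?_
      fun_prop)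
    (fun g z => by
      rw [← iteratedDeriv_smul_line_zero hD.isOpen h0 hh,
        ← iteratedDeriv_smul_line_zero hD.isOpen h0 hh]
      refine Filter.EventuallyEq.iteratedDeriv_eq k ?_
      have ht : Tendsto (fun t : ℂ => t • z) (𝓝 0) (𝓝 0) := by
        simpa using (by fun_prop : Continuous fun t : ℂ => t • z).tendsto 0
      filter_upwards [ht.eventually (hD.isOpen.mem_nhds h0)] with t ht
      rw [← map_smul]
      exact hinv g _ ht)
  -- Positive degree makes the homogeneous part vanish at 0, so its constant value is 0.
  have : Nonempty (Fin k) := ⟨⟨0, Nat.pos_of_ne_zero hk⟩⟩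
  exact (hc z).trans <| (hc 0).symm.trans (iteratedFDeriv ℂ k h 0).map_zero

variable (μ : Measure (CSpace n)) [μ.IsAddHaarMeasure]

/-- `D` has finite positive volume and equals its own image. -/
theorem IsInvariantUnder.abs_det_eq_one (hinv : IsInvariantUnder ρ D) (hD : IsBoundedDomain D)
    (g : K) : |((ρ g).toContinuousLinearMap.restrictScalars ℝ).det| = 1 := by
  set μ : Measure (CSpace n) := Measure.addHaar
  have h := Measure.addHaar_image_continuousLinearMap μ
    ((ρ g).toContinuousLinearMap.restrictScalars ℝ) D
  have himg : ((ρ g).toContinuousLinearMap.restrictScalars ℝ) '' D = D := hinv g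
  rw [himg] at h
  have h1 := (ENNReal.eq_div_iff (hD.isOpen.measure_pos μ hD.isConnected.nonempty).ne'
    hD.isBounded.measure_lt_top.ne).mpr ((mul_comm _ _).trans h.symm)
  rw [ENNReal.div_self (hD.isOpen.measure_pos μ hD.isConnected.nonempty).ne'
    hD.isBounded.measure_lt_top.ne, ENNReal.ofReal_eq_one] at h1
  exact h1

theorem IsInvariantUnder.integrableOn_comp_iff (hinv : IsInvariantUnder ρ D)
    (hD : IsBoundedDomain D) (g : K) {G : Type*} [NormedAddCommGroup G] [NormedSpace ℝ G]
    (h : CSpace n → G) : IntegrableOn (fun z => h (ρ g z)) D μ ↔ IntegrableOn h D μ := by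
  have := integrableOn_image_iff_integrableOn_abs_det_fderiv_smul μ hD.isOpen.measurableSet
    (fun x _ => ((ρ g).toContinuousLinearMap.restrictScalars ℝ).hasFDerivWithinAt (x := x))
    (ρ.apply_bijective g).injective.injOn h
  simp only [hinv.abs_det_eq_one hD, one_smul] at this
  have himg : ((ρ g).toContinuousLinearMap.restrictScalars ℝ) '' D = D := hinv g
  rw [himg] at this
  exact this.symm

theorem IsInvariantUnder.setIntegral_comp (hinv : IsInvariantUnder ρ D)
    (hD : IsBoundedDomain D) (g : K) {G : Type*} [NormedAddCommGroup G] [NormedSpace ℝ G]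
    (h : CSpace n → G) : ∫ z in D, h (ρ g z) ∂μ = ∫ z in D, h z ∂μ := by
  have := integral_image_eq_integral_abs_det_fderiv_smul μ hD.isOpen.measurableSet
    (fun x _ => ((ρ g).toContinuousLinearMap.restrictScalars ℝ).hasFDerivWithinAt (x := x))
    (ρ.apply_bijective g).injective.injOn h
  simp only [hinv.abs_det_eq_one hD, one_smul] at this
  have himg : ((ρ g).toContinuousLinearMap.restrictScalars ℝ) '' D = D := hinv g
  rw [himg] at this
  exact this.symm

/-- The mean value property of integrable holomorphic functions on an invariant domain. -/
theorem InvariantEntireFunctionsConstant.setIntegral_eq [TopologicalSpace K]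
    [IsTopologicalGroup K] [CompactSpace K] (hconst : InvariantEntireFunctionsConstant ρ)
    (hρ : IsContinuousRep ρ) (hinv : IsInvariantUnder ρ D) (hD : IsBoundedDomain D)
    (h0 : (0 : CSpace n) ∈ D) {h : CSpace n → ℂ} (hh : DifferentiableOn ℂ h D)
    (hint : IntegrableOn h D μ) : ∫ z in D, h z ∂μ = μ.real D • h 0 := by
  let _ : MeasurableSpace K := borel K
  have : BorelSpace K := ⟨rfl⟩
  let ν : Measure K := Measure.haarMeasure ⊤
  have hν : IsProbabilityMeasure ν := ⟨by
    simpa using Measure.haarMeasure_self (K₀ := (⊤ : TopologicalSpace.PositiveCompacts K))⟩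
  have hcont : Continuous fun p : K × CSpace n => ρ p.1⁻¹ p.2 :=
    Continuous.comp (g := fun p : K × CSpace n => ρ p.1 p.2) hρ
      (f := fun p : K × CSpace n => (p.1⁻¹, p.2)) (by fun_prop)
  have hcontOn : ContinuousOn (fun p : K × CSpace n => h (ρ p.1⁻¹ p.2)) (univ ×ˢ D) :=
    hh.continuousOn.comp hcont.continuousOn fun p hp => hinv.map_mem _ hp.2
  have hcK : ∀ z ∈ D, Continuous fun g : K => h (ρ g⁻¹ z) := fun z hz =>
    hcontOn.comp_continuous (f := fun g : K => (g, z)) (by fun_prop) fun g => ⟨trivial, hz⟩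
  have hfin : IsFiniteMeasure (μ.restrict D) := ⟨by
    simpa using hD.isBounded.measure_lt_top⟩
  set A : CSpace n → ℂ := fun z => ∫ g, h (ρ g⁻¹ z) ∂ν with hA
  have hAdiff : DifferentiableOn ℂ A D := by
    intro z₀ hz₀
    obtain ⟨r, hr, hball⟩ := Metric.nhds_basis_closedBall.mem_iff.mp (hD.isOpen.mem_nhds hz₀)
    obtain ⟨M, hM⟩ := (isCompact_univ.prod (isCompact_closedBall z₀ r)).exists_bound_of_continuousOn
      (hcontOn.mono (prod_mono_right hball))
    refine (differentiableAt_integral_of_norm_le hr (M := M)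
      (fun z hz => (hcK z (hball (ball_subset_closedBall hz))).aestronglyMeasurable)
      (fun g => ?_) (fun g z hz => hM (g, z)
        ⟨trivial, ball_subset_closedBall hz⟩)).differentiableWithinAt
    exact hh.comp (ρ g⁻¹).toContinuousLinearMap.differentiable.differentiableOn
      fun z hz => hinv.map_mem _ (hball (ball_subset_closedBall hz))
  have hAinv : ∀ g, ∀ z ∈ D, A (ρ g z) = A z := by
    intro g z hz
    -- The inverse in `A` turns the action of `g` into a left translation: `k⁻¹ * g = (g⁻¹ * k)⁻¹`.
    have := integral_mul_left_eq_self (μ := ν) (fun k => h (ρ k⁻¹ z)) g⁻¹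
    simpa [hA, map_mul] using this
  have hAconst := hconst.eqOn_const hD h0 hAdiff hAinv
  have hA0 : A 0 = h 0 := by simp [hA]
  have hprod : Integrable (Function.uncurry fun (g : K) (z : CSpace n) => h (ρ g⁻¹ z))
      (ν.prod (μ.restrict D)) := by
    have hmeas : AEStronglyMeasurable
        (Function.uncurry fun (g : K) (z : CSpace n) => h (ρ g⁻¹ z)) (ν.prod (μ.restrict D)) := by
      have := hcontOn.aestronglyMeasurable (μ := ν.prod μ)
        (MeasurableSet.univ.prod hD.isOpen.measurableSet)
      rwa [← Measure.prod_restrict, Measure.restrict_univ] at this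
    refine (integrable_prod_iff hmeas).mpr ⟨ae_of_all _ fun g =>
      (hinv.integrableOn_comp_iff μ hD g⁻¹ h).mpr hint, ?_⟩
    simp only [Function.uncurry_apply_pair]
    -- By volume preservation the inner norm integral does not depend on `g`.
    have : (fun g : K => ∫ z in D, ‖h (ρ g⁻¹ z)‖ ∂μ) = fun _ => ∫ z in D, ‖h z‖ ∂μ :=
      funext fun g => hinv.setIntegral_comp μ hD g⁻¹ fun z => ‖h z‖
    rw [this]
    exact integrable_const _
  have hswap := integral_integral_swap hprod
  simp only [hinv.setIntegral_comp μ hD _ h, integral_const, probReal_univ, one_smul] at hswap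
  rw [hswap, setIntegral_congr_fun hD.isOpen.measurableSet fun z hz => (hAconst z hz).trans hA0]
  simp

end Representation

/-! ### Square-integrability and variance of the Jacobian. -/

section Biholomorphism

variable {D : Set (CSpace n)} {f F : CSpace n → CSpace n} (μ : Measure (CSpace n))
  [μ.IsAddHaarMeasure]

theorem hasFDerivWithinAt_restrictScalars_of_isOpen (hD : IsOpen D) (hf : DifferentiableOn ℂ f D) :
    ∀ z ∈ D, HasFDerivWithinAt f ((fderiv ℂ f z).restrictScalars ℝ) D z := fun _ hz =>
  ((hf.differentiableAt (hD.mem_nhds hz)).hasFDerivAt.restrictScalars ℝ).hasFDerivWithinAt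

theorem integrableOn_norm_complexJacobian_sq (hD : IsOpen D) (hf : DifferentiableOn ℂ f D)
    (hinj : InjOn f D) (hbdd : Bornology.IsBounded (f '' D)) :
    IntegrableOn (fun z => ‖complexJacobian f z‖ ^ 2) D μ := by
  have h := (integrableOn_image_iff_integrableOn_abs_det_fderiv_smul μ hD.measurableSet
    (hasFDerivWithinAt_restrictScalars_of_isOpen hD hf) hinj fun _ => (1 : ℝ)).mp
    (integrableOn_const hbdd.measure_lt_top.ne)
  simp only [abs_det_restrictScalars_real, smul_eq_mul, mul_one] at h
  exact h

theorem setIntegral_norm_complexJacobian_sq (hD : IsOpen D) (hf : DifferentiableOn ℂ f D)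
    (hinj : InjOn f D) :
    ∫ z in D, ‖complexJacobian f z‖ ^ 2 ∂μ = μ.real (f '' D) := by
  have h := integral_image_eq_integral_abs_det_fderiv_smul μ hD.measurableSet
    (hasFDerivWithinAt_restrictScalars_of_isOpen hD hf) hinj fun _ => (1 : ℝ)
  simp only [abs_det_restrictScalars_real, smul_eq_mul, mul_one, setIntegral_const] at h
  exact h.symm

theorem integrableOn_complexJacobian (hD : IsBoundedDomain D) (hf : DifferentiableOn ℂ f D)
    (hinj : InjOn f D) (hbdd : Bornology.IsBounded (f '' D)) :
    IntegrableOn (complexJacobian f) D μ := by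
  refine ((integrableOn_const hD.isBounded.measure_lt_top.ne (C := (1 : ℝ))).add
    (integrableOn_norm_complexJacobian_sq μ hD.isOpen hf hinj hbdd)).mono'
    ((differentiableOn_complexJacobian hD.isOpen hf).continuousOn.aestronglyMeasurable
      hD.isOpen.measurableSet) (ae_of_all _ fun z => ?_)
  simp only [Pi.add_apply]
  -- Domination by `|J| ≤ 1 + |J|²`.
  nlinarith [sq_nonneg (‖complexJacobian f z‖ - 1), norm_nonneg (complexJacobian f z)]

theorem integrableOn_norm_complexJacobian_sub_sq (hD : IsBoundedDomain D)
    (hf : DifferentiableOn ℂ f D) (hinj : InjOn f D) (hbdd : Bornology.IsBounded (f '' D)) (c : ℂ) :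
    IntegrableOn (fun z => ‖complexJacobian f z - c‖ ^ 2) D μ := by
  refine (((integrableOn_const hD.isBounded.measure_lt_top.ne (C := 2 * ‖c‖ ^ 2)).add
    ((integrableOn_norm_complexJacobian_sq μ hD.isOpen hf hinj hbdd).const_mul 2))).mono'
    ((((differentiableOn_complexJacobian hD.isOpen hf).continuousOn.sub
      continuousOn_const).norm.pow 2).aestronglyMeasurable
      hD.isOpen.measurableSet) (ae_of_all _ fun z => ?_)
  simp only [Pi.add_apply, norm_pow, norm_norm]
  have h := norm_sub_le (complexJacobian f z) c
  have h' := pow_le_pow_left₀ (norm_nonneg _) h 2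
  nlinarith [sq_nonneg (‖complexJacobian f z‖ - ‖c‖)]

/-- The variance of the Jacobian determinant of an injective holomorphic map whose Jacobian
determinant satisfies the mean value property. -/
theorem setIntegral_norm_complexJacobian_sub_sq (hD : IsBoundedDomain D)
    (hf : DifferentiableOn ℂ f D) (hinj : InjOn f D) (hbdd : Bornology.IsBounded (f '' D)) {c : ℂ}
    (hmean : ∫ z in D, complexJacobian f z ∂μ = μ.real D • c) :
    ∫ z in D, ‖complexJacobian f z - c‖ ^ 2 ∂μ = μ.real (f '' D) - ‖c‖ ^ 2 * μ.real D := by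
  have hJ := integrableOn_complexJacobian μ hD hf hinj hbdd
  have hJ2 := integrableOn_norm_complexJacobian_sq μ hD.isOpen hf hinj hbdd
  have hcJ : IntegrableOn (fun z => (starRingEnd ℂ c * complexJacobian f z).re) D μ :=
    (hJ.const_mul (starRingEnd ℂ c)).re
  have hc : IntegrableOn (fun _ => ‖c‖ ^ 2) D μ :=
    integrableOn_const hD.isBounded.measure_lt_top.ne
  have hexp : ∀ z, ‖complexJacobian f z - c‖ ^ 2 = ‖complexJacobian f z‖ ^ 2 -
      2 * (starRingEnd ℂ c * complexJacobian f z).re + ‖c‖ ^ 2 := by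
    intro z
    simp only [← Complex.normSq_eq_norm_sq, Complex.normSq_sub, Complex.mul_re, Complex.conj_re,
      Complex.conj_im]
    ring
  -- The cross term is where the mean value property enters.
  have hre : ∫ z in D, (starRingEnd ℂ c * complexJacobian f z).re ∂μ = ‖c‖ ^ 2 * μ.real D := by
    have h1 : ∫ z in D, (starRingEnd ℂ c * complexJacobian f z).re ∂μ =
        (∫ z in D, starRingEnd ℂ c * complexJacobian f z ∂μ).re :=
      integral_re (𝕜 := ℂ) (hJ.const_mul (starRingEnd ℂ c))
    rw [h1, integral_const_mul, hmean, Complex.real_smul, ← Complex.normSq_eq_norm_sq]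
    simp [Complex.normSq_apply]
    ring
  simp only [hexp]
  have hadd := integral_add (hJ2.sub (hcJ.const_mul 2)) hc
  simp only [Pi.sub_apply] at hadd
  rw [hadd, integral_sub hJ2 (hcJ.const_mul 2),
    integral_const_mul, hre, setIntegral_norm_complexJacobian_sq μ hD.isOpen hf hinj,
    setIntegral_const]
  simp only [smul_eq_mul]
  ring

theorem complexJacobian_mul_complexJacobian_of_leftInvOn {z : CSpace n} (hD : IsOpen D)
    (hz : z ∈ D) (hf : DifferentiableAt ℂ f z) (hF : DifferentiableAt ℂ F (f z))
    (hinv : LeftInvOn F f D) : complexJacobian F (f z) * complexJacobian f z = 1 := by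
  have h : HasFDerivAt (F ∘ f) ((fderiv ℂ F (f z)).comp (fderiv ℂ f z)) z :=
    hF.hasFDerivAt.comp z hf.hasFDerivAt
  have h' : HasFDerivAt (F ∘ f) (ContinuousLinearMap.id ℂ (CSpace n)) z :=
    (hasFDerivAt_id z).congr_of_eventuallyEq (by
      filter_upwards [hD.mem_nhds hz] with w hw using hinv hw)
  have h1 := congrArg ContinuousLinearMap.det (h.unique h')
  rw [complexJacobian, complexJacobian]
  simpa [ContinuousLinearMap.det] using h1

end Biholomorphism

/-! ### Comparison of the variances of `f` and its inverse. -/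

theorem proposition3p1 {n : ℕ}
    {K : Type*} [Group K] [TopologicalSpace K] [IsTopologicalGroup K] [CompactSpace K]
    {K' : Type*} [Group K'] [TopologicalSpace K'] [IsTopologicalGroup K'] [CompactSpace K']
    (ρ : Representation ℂ K (CSpace n)) (ρ' : Representation ℂ K' (CSpace n))
    (hρ : IsContinuousRep ρ) (hρ' : IsContinuousRep ρ')
    (hconst : InvariantEntireFunctionsConstant ρ)
    (hconst' : InvariantEntireFunctionsConstant ρ')
    (D D' : Set (CSpace n)) (hD : IsBoundedDomain D) (hD' : IsBoundedDomain D')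
    (h0 : (0 : CSpace n) ∈ D) (h0' : (0 : CSpace n) ∈ D')
    (hinv : IsInvariantUnder ρ D) (hinv' : IsInvariantUnder ρ' D')
    (f : CSpace n → CSpace n) (hf : IsBiholomorphism f D D') (hf0 : f 0 = 0) :
    ∃ c : ℂ, ∀ z ∈ D, complexJacobian f z = c := by
  obtain ⟨hfd, hfm, F, hFd, hFm, hFf⟩ := hf
  let μ : Measure (CSpace n) := Measure.addHaar
  have hfimg : f '' D = D' := hFf.bijOn hfm hFm |>.image_eq
  have hFimg : F '' D' = D := hFf.symm.bijOn hFm hfm |>.image_eq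
  have hfinj : InjOn f D := hFf.1.injOn
  have hFinj : InjOn F D' := hFf.2.injOn
  have hfb : Bornology.IsBounded (f '' D) := hfimg ▸ hD'.isBounded
  have hFb : Bornology.IsBounded (F '' D') := hFimg ▸ hD.isBounded
  have hJ := differentiableOn_complexJacobian hD.isOpen hfd
  have hf_var := setIntegral_norm_complexJacobian_sub_sq μ hD hfd hfinj hfb
    (hconst.setIntegral_eq μ hρ hinv hD h0 hJ (integrableOn_complexJacobian μ hD hfd hfinj hfb))
  have hF_var := setIntegral_norm_complexJacobian_sub_sq μ hD' hFd hFinj hFb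
    (hconst'.setIntegral_eq μ hρ' hinv' hD' h0' (differentiableOn_complexJacobian hD'.isOpen hFd)
      (integrableOn_complexJacobian μ hD' hFd hFinj hFb))
  rw [hfimg] at hf_var
  rw [hFimg] at hF_var
  have hmul := complexJacobian_mul_complexJacobian_of_leftInvOn hD.isOpen h0
    (hfd.differentiableAt (hD.isOpen.mem_nhds h0))
    (hFd.differentiableAt (hf0.symm ▸ hD'.isOpen.mem_nhds h0')) hFf.1
  rw [hf0] at hmul
  have hmul2 : ‖complexJacobian F 0‖ ^ 2 * ‖complexJacobian f 0‖ ^ 2 = 1 := by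
    rw [← mul_pow, ← norm_mul, hmul]; simp
  have hf_nn : 0 ≤ ∫ z in D, ‖complexJacobian f z - complexJacobian f 0‖ ^ 2 ∂μ :=
    integral_nonneg fun _ => by positivity
  have hF_nn : 0 ≤ ∫ z in D', ‖complexJacobian F z - complexJacobian F 0‖ ^ 2 ∂μ :=
    integral_nonneg fun _ => by positivity
  have hzero : ∫ z in D, ‖complexJacobian f z - complexJacobian f 0‖ ^ 2 ∂μ = 0 := by
    refine le_antisymm ?_ hf_nn
    rw [hf_var]
    rw [hF_var] at hF_nn
    -- Scaling by `|J_f(0)|²` turns the inequality for `F` into `|J_f(0)|² vol(D) - vol(D') ≥ 0`.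
    have h := mul_nonneg (sq_nonneg ‖complexJacobian f 0‖) hF_nn
    linear_combination h - μ.real D' * hmul2
  rw [setIntegral_eq_zero_iff_of_nonneg_ae (ae_of_all _ fun _ => by positivity)
    (integrableOn_norm_complexJacobian_sub_sq μ hD hfd hfinj hfb _)] at hzero
  -- Continuity on the open set `D` upgrades almost everywhere equality to equality everywhere.
  refine ⟨complexJacobian f 0, Measure.eqOn_open_of_ae_eq (μ := μ) ?_ hD.isOpen hJ.continuousOn
    continuousOn_const⟩
  filter_upwards [hzero] with z hz
  simpa [sub_eq_zero] using hz
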